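/- Let $G$ be a countable discrete amenable group acting continuously on compact metric spaces $(X,d)$ and $(Y,d')$. Let $G$ act on $X\times Y$ by $g(x,y)=(gx,gy)$, and equip $X\times Y$ with the metric $(d\times d')((x_1,y_1),(x_2,y_2))=\max\{d(x_1,x_2),d'(y_1,y_2)\}$. A Følner sequence of $G$ is a sequence $\{F_n\}$ of nonempty finite subsets of $G$ with $|F_n\setminus gF_n|/|F_n|\to 0$ for every $g\in G$. For a finite nonempty $F\subset G$ let $d_F(x,y)=\max_{g\in F}d(gx,gy)$, and for compact $E\subset X$ and $\varepsilon>0$ let $s_F(d,\varepsilon,E)$ be the maximal cardinality of a set $K\subset E$ with $d_F(x,y)>\varepsilon$ for all distinct $x,y\in K$. For a Følner sequence $\{F_n\}$ put $s(d,\varepsilon,\{F_n\},E)=\limsup_{n\to\infty}\frac1{|F_n|}\log s_{F_n}(d,\varepsilon,E)$ (with $\log 0=-\infty$) and define the upper and lower metric mean dimensions $$\overline{\mathrm{mdim}}_M(E,G,d)=\limsup_{\varepsilon\to0^+}\frac{s(d,\varepsilon,\{F_n\},E)}{|\log\varepsilon|},\qquad \underline{\mathrm{mdim}}_M(E,G,d)=\liminf_{\varepsilon\to0^+}\frac{s(d,\varepsilon,\{F_n\},E)}{|\log\varepsilon|}.$$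 When they coincide, the common value in $[-\infty,+\infty]$ (in $[0,+\infty]$ if $E\neq\emptyset$) is the metric mean dimension $\mathrm{mdim}_M(E,G,d)$. The same definitions apply to $(Y,d')$ and to $(X\times Y,d\times d')$. Let $M\subset X$ and $L\subset Y$ be compact. Assume that each of $M$ and $L$ either is $G$-invariant ($gE\subset E$ for all $g\in G$) or has upper and lower metric mean dimensions which do not depend on the choice of the Følner sequence. If, for some Følner sequence $\{F_n\}$, $$\underline{\mathrm{mdim}}_M(M,G,d)=\overline{\mathrm{mdim}}_M(M,G,d)\quad\text{and}\quad \underline{\mathrm{mdim}}_M(L,G,d')=\overline{\mathrm{mdim}}_M(L,G,d'),$$ then the metric mean dimension of $M\times L$ exists with respect to every Følner sequence of $G$, does not depend on that sequence, and $$\mathrm{mdim}_M(M\times L,G,d\times d')=\mathrm{mdim}_M(M,G,d)+\mathrm{mdim}_M(L,G,d').$$ (If $M$ or $L$ is empty, both sides are $-\infty$.) -/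

import Mathlib

open Filter Topology

noncomputable section

namespace AmenableMdim

/-- A Følner sequence of a (discrete) group: nonempty finite subsets `F n` such that
`|F n \ g (F n)| / |F n| → 0` for every `g`. -/
structure IsFolnerSeq {G : Type*} [Group G] (F : ℕ → Finset G) : Prop where
  nonempty : ∀ n, (F n).Nonempty
  tendsto : ∀ g : G, Tendsto
    (fun n => (Set.ncard ((F n : Set G) \ ((fun h => g * h) '' (F n : Set G))) : ℝ) /
      ((F n).card : ℝ)) atTop (𝓝 0)

/-- The metric `d_F (x, y) = max_{g ∈ F} d (g x, g y)` (for `F` nonempty). -/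
def dynDist {G X : Type*} [Group G] [MetricSpace X] [MulAction G X]
    (F : Finset G) (x y : X) : ℝ :=
  ((F.sup fun g => nndist (g • x) (g • y) : NNReal) : ℝ)

/-- `K` is `(F, ε)`-separated: distinct points of `K` are at `d_F`-distance `> ε`. -/
def IsSep {G X : Type*} [Group G] [MetricSpace X] [MulAction G X]
    (F : Finset G) (ε : ℝ) (K : Set X) : Prop :=
  ∀ x ∈ K, ∀ y ∈ K, x ≠ y → ε < dynDist F x y

/-- `s_F(d, ε, E)`: the maximal cardinality of an `(F, ε)`-separated subset of `E`. -/
def sepNum {G X : Type*} [Group G] [MetricSpace X] [MulAction G X]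
    (F : Finset G) (ε : ℝ) (E : Set X) : ℕ∞ :=
  ⨆ K : {K : Set X // K ⊆ E ∧ IsSep F ε K}, (K : Set X).encard

/-- `s(d, ε, {F n}, E) = limsup_n (1 / |F n|) log s_{F n}(d, ε, E)`, with `log 0 = -∞`. -/
def sepRate {G X : Type*} [Group G] [MetricSpace X] [MulAction G X]
    (F : ℕ → Finset G) (ε : ℝ) (E : Set X) : EReal :=
  limsup (fun n => ENNReal.log ((sepNum (F n) ε E : ℕ∞) : ENNReal) /
    (((F n).card : ℝ) : EReal)) atTop

/-- Upper metric mean dimension of `E`, computed along the sequence `F`. -/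
def upperMdim {G X : Type*} [Group G] [MetricSpace X] [MulAction G X]
    (F : ℕ → Finset G) (E : Set X) : EReal :=
  limsup (fun ε : ℝ => sepRate F ε E / ((|Real.log ε| : ℝ) : EReal)) (𝓝[>] 0)

/-- Lower metric mean dimension of `E`, computed along the sequence `F`. -/
def lowerMdim {G X : Type*} [Group G] [MetricSpace X] [MulAction G X]
    (F : ℕ → Finset G) (E : Set X) : EReal :=
  liminf (fun ε : ℝ => sepRate F ε E / ((|Real.log ε| : ℝ) : EReal)) (𝓝[>] 0)

/-- `E` is invariant under the action of `G`. -/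
def IsInvariantSet (G : Type*) {X : Type*} [Group G] [MulAction G X] (E : Set X) : Prop :=
  ∀ g : G, ∀ x ∈ E, g • x ∈ E

/-- The upper and lower metric mean dimensions of `E` do not depend on the choice of the
Følner sequence. -/
def IsFolnerIndependent (G : Type*) {X : Type*} [Group G] [MetricSpace X] [MulAction G X]
    (E : Set X) : Prop :=
  ∀ F F' : ℕ → Finset G, IsFolnerSeq F → IsFolnerSeq F' →
    upperMdim F E = upperMdim F' E ∧ lowerMdim F E = lowerMdim F' E

end AmenableMdim

end

/-!
The metric mean dimension of a product is subadditive along every Følner sequence, because a cover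
of `M` and a cover of `L` by sets of `d_F`-diameter at most `ε` multiply to a cover of `M ×ˢ L`, and
covering and separation numbers agree up to halving the scale (`upperMdim_prod_le`); halving `ε`
does not change `|log ε|` asymptotically (`limsup_div_abs_log_le`, `liminf_div_abs_log_le`).

For the opposite inequality, the product of separated sets is separated, so the normalised
logarithms of the separation numbers are superadditive for each single `F n`. The upper limit over
`n` need not respect this. One therefore chooses scales `ε_j → 0` at which the normalised rate of
the product stays below a given `b` exceeding its lower metric mean dimension and, by compactness of
`EReal × EReal` and a diagonal argument, a subsequence of `F` along which all the entropies of `M`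
and `L` at the scales `ε_j` converge (`exists_subseq_lowerMdim_add_le`). This bounds the lower dimension of the product from
below by the lower dimensions of the factors along a *subsequence* of `F`, and these agree with the
given ones as soon as the dimensions of `M` and `L` do not depend on the Følner sequence.

It remains to see that invariant sets have this independence
(`IsInvariantSet.isFolnerIndependent`). For invariant `E` the function `F ↦ log (covNum F ε E)` is
nonnegative, subadditive and does not increase under right translation, so the Ornstein–Weiss
inequality applies: a sufficiently left-invariant finite set is, up to a small part, an almost
disjoint union of right translates of finitely many tiles taken from another Følner sequence
(`IsOWFunction.exists_large_subset`). The tiles are packed greedily (`exists_packing`).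
-/

noncomputable section

namespace AmenableMdim

/-! ### Dynamical colourings -/

section Colouring

variable {G X Y : Type*} [Group G] [MetricSpace X] [MulAction G X] [MetricSpace Y] [MulAction G Y]

lemma dynDist_le_iff {F : Finset G} {ε : ℝ} (hε : 0 ≤ ε) {x y : X} :
    dynDist F x y ≤ ε ↔ ∀ g ∈ F, dist (g • x) (g • y) ≤ ε := by
  lift ε to NNReal using hε
  simp only [dynDist, NNReal.coe_le_coe, Finset.sup_le_iff, ← coe_nndist]

/-- A colouring of the space such that points of `E` of the same colour are `ε`-close for `d_F`;
for `ε ≥ 0` and nonempty `E` this amounts to a cover of `E` by sets of `d_F`-diameter at most `ε`,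
indexed by the colours. -/
def IsFineColouring {κ : Type*} (F : Finset G) (ε : ℝ) (E : Set X) (c : X → κ) : Prop :=
  ∀ x ∈ E, ∀ y ∈ E, c x = c y → dynDist F x y ≤ ε

/-- The least number of colours in a fine colouring, that is, for `ε ≥ 0` and nonempty `E`, the least
number of sets of `d_F`-diameter at most `ε` which cover `E`. Unlike `sepNum`, it is submultiplicative in `F`. On a
compact space and for `ε > 0` the infimum is over a nonempty set (`exists_covNum_colouring`). -/
def covNum (F : Finset G) (ε : ℝ) (E : Set X) : ℕ :=
  sInf {n : ℕ | ∃ c : X → Fin n, IsFineColouring F ε E c}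

lemma IsFineColouring.covNum_le {κ : Type*} [Fintype κ] {F : Finset G} {ε : ℝ} {E : Set X}
    {c : X → κ} (hc : IsFineColouring F ε E c) : covNum F ε E ≤ Fintype.card κ :=
  Nat.sInf_le ⟨Fintype.equivFin κ ∘ c, fun x hx y hy h =>
    hc x hx y hy ((Fintype.equivFin κ).injective h)⟩

lemma exists_dist_colouring (X : Type*) [MetricSpace X] [CompactSpace X] {ε : ℝ} (hε : 0 < ε) :
    ∃ (n : ℕ) (c : X → Fin n), ∀ x y, c x = c y → dist x y ≤ ε := by
  obtain ⟨t, ht, hcov⟩ :=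
    Metric.totallyBounded_iff.1 (isCompact_univ (X := X)).totallyBounded (ε / 2) (half_pos hε)
  have key : ∀ x : X, ∃ p : t, dist x p < ε / 2 := fun x => by
    obtain ⟨p, hp, hx⟩ := Set.mem_iUnion₂.1 (hcov (Set.mem_univ x))
    exact ⟨⟨p, hp⟩, hx⟩
  choose c hc using key
  have := ht.fintype
  refine ⟨Fintype.card t, Fintype.equivFin t ∘ c, fun x y h => ?_⟩
  have h' : c x = c y := (Fintype.equivFin t).injective h
  have h1 := hc x
  have h2 := hc y
  rw [← h'] at h2
  linarith [dist_triangle_right x y (c x : X)]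

/-- Pulling back one fixed colouring by the elements of `F` makes the number of colours needed at
most exponential in `|F|`. -/
lemma exists_fineColouring_pow [CompactSpace X] {ε : ℝ} (hε : 0 < ε) :
    ∃ n : ℕ, ∀ (F : Finset G) (E : Set X),
      ∃ c : X → (F → Fin n), IsFineColouring F ε E c := by
  obtain ⟨n, c, hc⟩ := exists_dist_colouring X hε
  refine ⟨n, fun F E => ⟨fun x g => c ((g : G) • x), fun x _ y _ h => ?_⟩⟩
  exact (dynDist_le_iff hε.le).2 fun g hg => hc _ _ (congrFun h ⟨g, hg⟩)

lemma exists_covNum_colouring [CompactSpace X] {ε : ℝ} (hε : 0 < ε) (F : Finset G) (E : Set X) :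
    ∃ c : X → Fin (covNum F ε E), IsFineColouring F ε E c := by
  classical
  obtain ⟨n, hn⟩ := exists_fineColouring_pow (G := G) (X := X) hε
  obtain ⟨c, hc⟩ := hn F E
  refine Nat.sInf_mem (s := {n : ℕ | ∃ c : X → Fin n, IsFineColouring F ε E c})
    ⟨_, Fintype.equivFin _ ∘ c, fun x hx y hy h => hc x hx y hy ((Equiv.injective _) h)⟩

lemma exists_covNum_le_pow (G X : Type*) [Group G] [MetricSpace X] [MulAction G X]
    [CompactSpace X] {ε : ℝ} (hε : 0 < ε) :
    ∃ n : ℕ, ∀ (F : Finset G) (E : Set X), covNum F ε E ≤ n ^ F.card := by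
  classical
  obtain ⟨n, hn⟩ := exists_fineColouring_pow (G := G) (X := X) hε
  refine ⟨n, fun F E => ?_⟩
  obtain ⟨c, hc⟩ := hn F E
  simpa using hc.covNum_le

lemma covNum_pos [CompactSpace X] {ε : ℝ} (hε : 0 < ε) (F : Finset G) {E : Set X}
    (hE : E.Nonempty) : 0 < covNum F ε E := by
  obtain ⟨c, -⟩ := exists_covNum_colouring hε F E
  exact (c hE.some).pos

lemma covNum_union_le [CompactSpace X] [DecidableEq G] {ε : ℝ} (hε : 0 < ε) (F F' : Finset G)
    (E : Set X) : covNum (F ∪ F') ε E ≤ covNum F ε E * covNum F' ε E := by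
  obtain ⟨c, hc⟩ := exists_covNum_colouring hε F E
  obtain ⟨c', hc'⟩ := exists_covNum_colouring hε F' E
  have : IsFineColouring (F ∪ F') ε E fun x => (c x, c' x) := fun x hx y hy h => by
    have h1 := (dynDist_le_iff hε.le).1 (hc x hx y hy (congrArg Prod.fst h))
    have h2 := (dynDist_le_iff hε.le).1 (hc' x hx y hy (congrArg Prod.snd h))
    exact (dynDist_le_iff hε.le).2 fun g hg => (Finset.mem_union.1 hg).elim (h1 g) (h2 g)
  simpa using this.covNum_le

lemma covNum_image_mul_right_le [CompactSpace X] [DecidableEq G] {ε : ℝ} (hε : 0 < ε)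
    (F : Finset G) {E : Set X} (hE : IsInvariantSet G E) (g : G) :
    covNum (F.image (· * g)) ε E ≤ covNum F ε E := by
  obtain ⟨c, hc⟩ := exists_covNum_colouring hε F E
  have : IsFineColouring (F.image (· * g)) ε E fun x => c (g • x) := fun x hx y hy h => by
    have h1 := (dynDist_le_iff hε.le).1 (hc _ (hE g x hx) _ (hE g y hy) h)
    refine (dynDist_le_iff hε.le).2 fun k hk => ?_
    obtain ⟨f, hf, rfl⟩ := Finset.mem_image.1 hk
    simpa [mul_smul] using h1 f hf
  simpa using this.covNum_le

lemma covNum_prod_le [CompactSpace X] [CompactSpace Y] {ε : ℝ} (hε : 0 < ε)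
    (F : Finset G) (M : Set X) (L : Set Y) :
    covNum F ε (M ×ˢ L) ≤ covNum F ε M * covNum F ε L := by
  obtain ⟨c, hc⟩ := exists_covNum_colouring hε F M
  obtain ⟨c', hc'⟩ := exists_covNum_colouring hε F L
  have : IsFineColouring F ε (M ×ˢ L) fun x => (c x.1, c' x.2) := fun x hx y hy h => by
    have h1 := (dynDist_le_iff hε.le).1 (hc x.1 hx.1 y.1 hy.1 (congrArg Prod.fst h))
    have h2 := (dynDist_le_iff hε.le).1 (hc' x.2 hx.2 y.2 hy.2 (congrArg Prod.snd h))
    exact (dynDist_le_iff hε.le).2 fun g hg => max_le (h1 g hg) (h2 g hg)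
  simpa using this.covNum_le

/-! ### Separated sets -/

lemma dynDist_self (F : Finset G) (x : X) : dynDist F x x = 0 := by
  simp [dynDist]

lemma dynDist_comm (F : Finset G) (x y : X) : dynDist F x y = dynDist F y x := by
  simp [dynDist, nndist_comm]

lemma IsSep.encard_le {F : Finset G} {ε : ℝ} {E K : Set X} (hKE : K ⊆ E) (hK : IsSep F ε K)
    {n : ℕ} {c : X → Fin n} (hc : IsFineColouring F ε E c) : K.encard ≤ n := by
  have hinj : Set.InjOn c K := fun x hx y hy h => by
    by_contra hne
    exact absurd (hc x (hKE hx) y (hKE hy) h) (not_le.2 (hK x hx y hy hne))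
  rw [← hinj.encard_image]
  simpa using Set.encard_le_encard (Set.subset_univ (c '' K))

lemma sepNum_le_covNum [CompactSpace X] {ε : ℝ} (hε : 0 < ε) (F : Finset G) (E : Set X) :
    sepNum F ε E ≤ covNum F ε E := by
  obtain ⟨c, hc⟩ := exists_covNum_colouring hε F E
  exact iSup_le fun K => K.2.2.encard_le K.2.1 hc

/-- A maximal separated set is a net: colouring each point by a nearby point of the net gives
classes of twice the diameter. -/
lemma covNum_two_mul_le_sepNum [CompactSpace X] {ε : ℝ} (hε : 0 < ε) (F : Finset G)
    (E : Set X) (hE : E.Nonempty) : (covNum F (2 * ε) E : ℕ∞) ≤ sepNum F ε E := by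
  have : Nonempty {K : Set X // K ⊆ E ∧ IsSep F ε K} :=
    ⟨⟨∅, Set.empty_subset _, fun x hx => hx.elim⟩⟩
  have hlt : sepNum F ε E < ⊤ :=
    (sepNum_le_covNum hε F E).trans_lt (ENat.natCast_lt_top _)
  obtain ⟨⟨K, hKE, hK⟩, hmax⟩ := ENat.exists_eq_iSup_of_lt_top hlt
  change K.encard = sepNum F ε E at hmax
  have hfin : K.Finite := Set.encard_lt_top_iff.1 (hmax ▸ hlt)
  have net : ∀ x ∈ E, ∃ p ∈ K, dynDist F x p ≤ ε := by
    intro x hx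
    by_contra! hfar
    have hxK : x ∉ K := fun h => by
      have := hfar x h
      rw [dynDist_self] at this
      exact this.not_ge hε.le
    have hsep : IsSep F ε (insert x K) := by
      rintro y (rfl | hy) z (rfl | hz) hne
      · exact absurd rfl hne
      · exact hfar z hz
      · exact dynDist_comm F z y ▸ hfar y hy
      · exact hK y hy z hz hne
    have hle : (insert x K).encard ≤ sepNum F ε E :=
      le_iSup (fun K : {K : Set X // K ⊆ E ∧ IsSep F ε K} => (K : Set X).encard)
        ⟨insert x K, Set.insert_subset hx hKE, hsep⟩
    rw [← hmax, Set.encard_insert_of_notMem hxK] at hle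
    exact absurd hle (not_le.2 (ENat.lt_add_one_iff (Set.encard_ne_top_iff.2 hfin) |>.2 le_rfl))
  obtain ⟨x₀, hx₀⟩ := hE
  obtain ⟨p₀, hp₀, -⟩ := net x₀ hx₀
  have : ∀ x, ∃ p : K, x ∈ E → dynDist F x p ≤ ε := fun x => by
    by_cases hx : x ∈ E
    · obtain ⟨p, hp, h⟩ := net x hx
      exact ⟨⟨p, hp⟩, fun _ => h⟩
    · exact ⟨⟨p₀, hp₀⟩, fun h => absurd h hx⟩
  choose c hc using this
  have hfine : IsFineColouring F (2 * ε) E c := fun x hx y hy h => by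
    have h1 := (dynDist_le_iff hε.le).1 (hc x hx)
    have h2 := (dynDist_le_iff hε.le).1 (hc y hy)
    rw [← h] at h2
    refine (dynDist_le_iff (by positivity)).2 fun g hg => ?_
    linarith [h1 g hg, h2 g hg, dist_triangle_right (g • x) (g • y) (g • (c x : X))]
  have := hfin.fintype
  rw [← hmax, Set.encard_eq_coe_toFinset_card, Set.toFinset_card]
  exact_mod_cast hfine.covNum_le

lemma IsSep.prod {F : Finset G} {ε : ℝ} (hε : 0 ≤ ε) {K : Set X} {K' : Set Y} (hK : IsSep F ε K)
    (hK' : IsSep F ε K') : IsSep F ε (K ×ˢ K') := by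
  rintro ⟨x, x'⟩ ⟨hx, hx'⟩ ⟨y, y'⟩ ⟨hy, hy'⟩ hne
  by_contra! hle
  rw [dynDist_le_iff hε] at hle
  have h1 : dynDist F x y ≤ ε :=
    (dynDist_le_iff hε).2 fun g hg => (le_max_left _ _).trans (hle g hg)
  have h2 : dynDist F x' y' ≤ ε :=
    (dynDist_le_iff hε).2 fun g hg => (le_max_right _ _).trans (hle g hg)
  have e1 : x = y := by_contra fun h => h1.not_gt (hK x hx y hy h)
  have e2 : x' = y' := by_contra fun h => h2.not_gt (hK' x' hx' y' hy' h)
  exact hne (by rw [e1, e2])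

lemma sepNum_mul_le {ε : ℝ} (hε : 0 ≤ ε) (F : Finset G) (M : Set X) (L : Set Y) :
    sepNum F ε M * sepNum F ε L ≤ sepNum F ε (M ×ˢ L) := by
  rw [sepNum, sepNum, ENat.iSup_mul]
  refine iSup_le fun K => ?_
  rw [ENat.mul_iSup]
  refine iSup_le fun K' => ?_
  rw [← Set.encard_prod]
  exact le_iSup (fun K : {K : Set (X × Y) // K ⊆ M ×ˢ L ∧ IsSep F ε K} => (K : Set (X × Y)).encard)
    ⟨(K : Set X) ×ˢ (K' : Set Y), Set.prod_mono K.2.1 K'.2.1, K.2.2.prod hε K'.2.2⟩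

end Colouring

/-! ### Quasi-tilings and the Ornstein–Weiss inequality -/

section Tiling

open scoped Pointwise

variable {G : Type*} [Group G] [DecidableEq G]

/-- The total defect of left `K`-invariance of `R`, summed over `K` without normalising by `|R|`. -/
def leftDefect (K R : Finset G) : ℕ := ∑ k ∈ K, (R \ k • R).card

lemma leftDefect_mono {K K' : Finset G} (h : K ⊆ K') (R : Finset G) :
    leftDefect K R ≤ leftDefect K' R :=
  Finset.sum_le_sum_of_subset h

/-- Most elements `c` of a nearly invariant set `R` carry a translate `T * c` inside `R`. -/
lemma card_le_card_core_add_leftDefect (T R : Finset G) :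
    R.card ≤ (R.filter fun c => T * {c} ⊆ R).card + leftDefect T⁻¹ R := by
  have hsub : R ⊆ (R.filter fun c => T * {c} ⊆ R) ∪ T⁻¹.biUnion fun k => R \ k • R := by
    intro c hc
    by_cases h : T * {c} ⊆ R
    · exact Finset.mem_union_left _ (Finset.mem_filter.2 ⟨hc, h⟩)
    · obtain ⟨x, hx, hxR⟩ := Finset.not_subset.1 h
      obtain ⟨t, ht, c', hc', rfl⟩ := Finset.mem_mul.1 hx
      obtain rfl := Finset.mem_singleton.1 hc'
      refine Finset.mem_union_right _ (Finset.mem_biUnion.2 ⟨t⁻¹, Finset.inv_mem_inv ht, ?_⟩)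
      rw [Finset.mem_sdiff]
      refine ⟨hc, fun hm => hxR ?_⟩
      rwa [Finset.mem_inv_smul_finset_iff, smul_eq_mul] at hm
  calc R.card ≤ _ := Finset.card_le_card hsub
    _ ≤ _ := Finset.card_union_le _ _
    _ ≤ _ := by gcongr; exact Finset.card_biUnion_le

/-- Every point lies in at most `|T|` right translates of `T`. -/
lemma sum_card_translate_inter_le (T A D : Finset G) :
    ∑ c ∈ D, ((T * {c}) ∩ A).card ≤ T.card * A.card := by
  have h : ∀ c, ((T * {c}) ∩ A).card = (T.filter fun t => t * c ∈ A).card := fun c => by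
    rw [← Finset.card_image_of_injective (T.filter fun t => t * c ∈ A) (mul_left_injective c)]
    congr 1
    ext x
    simp only [Finset.mem_inter, Finset.mem_mul, Finset.mem_singleton, Finset.mem_image,
      Finset.mem_filter]
    constructor
    · rintro ⟨⟨t, ht, _, rfl, rfl⟩, hx⟩
      exact ⟨t, ⟨ht, hx⟩, rfl⟩
    · rintro ⟨t, ⟨ht, hx⟩, rfl⟩
      exact ⟨⟨t, ht, c, rfl, rfl⟩, hx⟩
  simp_rw [h, Finset.card_filter]
  rw [Finset.sum_comm, ← smul_eq_mul, ← Finset.sum_const]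
  refine Finset.sum_le_sum fun t _ => ?_
  rw [← Finset.card_filter]
  exact Finset.card_le_card_of_injOn (fun c => t * c) (fun c hc => (Finset.mem_filter.1 hc).2)
    (mul_right_injective t).injOn

/-- Greedy packing: choose a largest set `C` of centres whose translates of `T` lie in `R` and
overlap little. By maximality every translate of `T` inside `R` meets `T * C` substantially, so
double counting shows that `T * C` is a definite part of `R`. -/
lemma exists_packing {T R : Finset G} (hT : T.Nonempty) {ε : ℝ} (hε1 : ε ≤ 1) :
    ∃ C : Finset G, T * C ⊆ R ∧ (1 - ε) * (T.card * C.card) ≤ (T * C).card ∧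
      ε * (R.filter fun c => T * {c} ⊆ R).card ≤ (T * C).card := by
  set D := R.filter fun c => T * {c} ⊆ R with hD
  set S := (T⁻¹ * R).powerset.filter fun C => T * C ⊆ R ∧
    (1 - ε) * (T.card * C.card) ≤ (T * C).card with hS
  have hmemS : ∀ C, C ∈ S ↔ T * C ⊆ R ∧ (1 - ε) * (T.card * C.card) ≤ (T * C).card := by
    intro C
    simp only [hS, Finset.mem_filter, Finset.mem_powerset, and_iff_right_iff_imp]
    rintro ⟨h, -⟩ c hc
    obtain ⟨t, ht⟩ := hT
    exact Finset.mem_mul.2 ⟨t⁻¹, Finset.inv_mem_inv ht, t * c, h (Finset.mul_mem_mul ht hc),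
      by simp⟩
  obtain ⟨C, hC, hmax⟩ := Finset.exists_max_image S Finset.card ⟨∅, (hmemS _).2 (by simp)⟩
  obtain ⟨hCR, hCc⟩ := (hmemS C).1 hC
  refine ⟨C, hCR, hCc, ?_⟩
  have hTpos : (0 : ℝ) < T.card := by exact_mod_cast hT.card_pos
  have hmeet : ∀ c ∈ D, ε * T.card ≤ ((T * {c}) ∩ (T * C)).card := by
    intro c hc
    have hcT : (T * {c}).card = T.card := Finset.card_mul_singleton T c
    by_cases hcC : c ∈ C
    · rw [Finset.inter_eq_left.2 (Finset.mul_subset_mul_left (Finset.singleton_subset_iff.2 hcC)),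
        hcT]
      nlinarith
    · by_contra! hlt
      have hins : insert c C ∈ S := by
        have hunion : T * insert c C = (T * {c}) ∪ (T * C) := by
          rw [Finset.insert_eq, Finset.mul_union]
        rw [hmemS, hunion]
        refine ⟨Finset.union_subset (Finset.mem_filter.1 hc).2 hCR, ?_⟩
        have h1 : (((T * {c}) ∪ (T * C)).card : ℝ) + ((T * {c}) ∩ (T * C)).card
            = T.card + (T * C).card := by
          rw [← hcT]
          exact_mod_cast Finset.card_union_add_card_inter _ _
        rw [Finset.card_insert_of_notMem hcC]
        push_cast
        linarith
      have := hmax _ hins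
      rw [Finset.card_insert_of_notMem hcC] at this
      omega
  have hdc : (∑ c ∈ D, (((T * {c}) ∩ (T * C)).card : ℝ)) ≤ T.card * (T * C).card := by
    exact_mod_cast sum_card_translate_inter_le T (T * C) D
  have hlow : (D.card : ℝ) * (ε * T.card) ≤ ∑ c ∈ D, (((T * {c}) ∩ (T * C)).card : ℝ) := by
    rw [← nsmul_eq_mul]
    exact Finset.card_nsmul_le_sum _ _ _ hmeet
  have := hlow.trans hdc
  exact le_of_mul_le_mul_left (by linarith) hTpos

/-- Removing translates of `T` from `R` adds at most the boundaries of the translates. -/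
lemma leftDefect_sdiff_le (K T C R : Finset G) :
    leftDefect K (R \ (T * C)) ≤ leftDefect K R + C.card * leftDefect K T := by
  rw [leftDefect, leftDefect, leftDefect, Finset.mul_sum, ← Finset.sum_add_distrib]
  refine Finset.sum_le_sum fun k _ => ?_
  have hsub : (R \ (T * C)) \ k • (R \ (T * C)) ⊆
      (R \ k • R) ∪ C.biUnion fun c => ((k • T) \ T) * {c} := by
    intro x hx
    rw [Finset.mem_sdiff, Finset.mem_sdiff] at hx
    obtain ⟨⟨hxR, hxA⟩, hxk⟩ := hx
    rw [Finset.mem_union]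
    by_cases h : x ∈ k • R
    · right
      rw [← Finset.inv_smul_mem_iff] at h hxk
      have hA : k⁻¹ • x ∈ T * C := by
        by_contra hA
        exact hxk (Finset.mem_sdiff.2 ⟨h, hA⟩)
      obtain ⟨t, ht, c, hc, htc⟩ := Finset.mem_mul.1 hA
      have hx : x = (k * t) * c := by
        rw [mul_assoc, htc, smul_eq_mul, mul_inv_cancel_left]
      refine Finset.mem_biUnion.2 ⟨c, hc, Finset.mem_mul.2 ⟨k * t, ?_, c,
        Finset.mem_singleton_self c, hx.symm⟩⟩
      refine Finset.mem_sdiff.2 ⟨Finset.smul_mem_smul_finset ht, fun hkt => hxA ?_⟩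
      exact hx ▸ Finset.mul_mem_mul hkt hc
    · exact Or.inl (Finset.mem_sdiff.2 ⟨hxR, h⟩)
  have hcard : ((k • T) \ T).card = (T \ k • T).card :=
    Finset.card_sdiff_comm (Finset.card_smul_finset k T)
  calc _ ≤ _ := Finset.card_le_card hsub
    _ ≤ _ := Finset.card_union_le _ _
    _ ≤ (R \ k • R).card + C.card * (T \ k • T).card := by
      gcongr
      refine Finset.card_biUnion_le_card_mul _ _ _ fun c _ => ?_
      rw [Finset.card_mul_singleton, hcard]

/-- The properties of `F ↦ log (covNum F ε E)`, for `E` invariant, on which the Ornstein–Weiss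
inequality rests. -/
structure IsOWFunction (h : Finset G → ℝ) : Prop where
  nonneg : ∀ A, 0 ≤ h A
  union_le : ∀ A B, h (A ∪ B) ≤ h A + h B
  mul_singleton_le : ∀ A c, h (A * {c}) ≤ h A
  empty : h ∅ = 0

lemma IsOWFunction.mul_le {h : Finset G → ℝ} (hh : IsOWFunction h) (T C : Finset G) :
    h (T * C) ≤ C.card * h T := by
  induction C using Finset.induction_on with
  | empty => simp [hh.empty]
  | insert c C hc ih =>
    rw [Finset.insert_eq, Finset.mul_union, ← Finset.insert_eq, Finset.card_insert_of_notMem hc]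
    push_cast
    linarith [hh.union_le (T * {c}) (T * C), hh.mul_singleton_le T c]

/-- Quasi-tiling by induction on the number of scales: one packing by translates of a very
invariant tile `T` reduces the uncovered part by the factor `1 - ε / 2`, and what remains is still
invariant enough for the tiles of the previous scales. -/
lemma IsOWFunction.exists_large_subset {h : Finset G → ℝ} (hh : IsOWFunction h) {l : ℝ}
    (htile : ∀ (K : Finset G) (δ : ℝ), 0 < δ → ∃ T : Finset G, T.Nonempty ∧
      leftDefect K T ≤ δ * T.card ∧ h T ≤ l * T.card)
    {ε : ℝ} (hε : 0 < ε) (hε1 : ε < 1) (n : ℕ) :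
    ∃ (K : Finset G) (δ : ℝ), 0 < δ ∧ ∀ R : Finset G, leftDefect K R ≤ δ * R.card →
      ∃ A ⊆ R, ((R \ A).card : ℝ) ≤ (1 - ε / 2) ^ n * R.card ∧ h A ≤ l / (1 - ε) * A.card := by
  induction n with
  | zero => exact ⟨∅, 1, one_pos, fun R _ => ⟨∅, by simp, by simp, by simp [hh.empty]⟩⟩
  | succ n ih =>
    obtain ⟨K, δ, hδ, ih⟩ := ih
    have hq : 0 < 1 - ε := by linarith
    set η := (1 - ε / 2) ^ (n + 1) with hη
    have hηpos : 0 < η := pow_pos (by linarith) _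
    -- A remainder which is not already small has at least `η * |R|` points. Half of the defect
    -- allowed for it is reserved for the tiles, whose total size is at most `|R| / (1 - ε)`.
    obtain ⟨T, hT, hTK, hTl⟩ := htile K (δ * η * (1 - ε) / 2) (by positivity)
    have hTpos : (0 : ℝ) < T.card := by exact_mod_cast hT.card_pos
    have hl : 0 ≤ l := by
      by_contra! hl
      nlinarith [hh.nonneg T]
    -- The bound `1 / 2` on the defect for `T⁻¹` lets half of `R` carry translates of `T`.
    refine ⟨K ∪ T⁻¹, min (δ * η / 2) (1 / 2), by positivity, fun R hR => ?_⟩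
    have hR0 : (0 : ℝ) ≤ R.card := Nat.cast_nonneg _
    have hRK : (leftDefect K R : ℝ) ≤ δ * η / 2 * R.card :=
      (Nat.cast_le.2 (leftDefect_mono Finset.subset_union_left R)).trans
        (hR.trans (by gcongr; exact min_le_left _ _))
    have hRT : (leftDefect T⁻¹ R : ℝ) ≤ 1 / 2 * R.card :=
      (Nat.cast_le.2 (leftDefect_mono Finset.subset_union_right R)).trans
        (hR.trans (by gcongr; exact min_le_right _ _))
    obtain ⟨C, hCR, hC, hCore⟩ := exists_packing (R := R) hT hε1.le
    have hcore : (R.card : ℝ) ≤ (R.filter fun c => T * {c} ⊆ R).card + leftDefect T⁻¹ R := by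
      exact_mod_cast card_le_card_core_add_leftDefect T R
    have hbig : ε / 2 * R.card ≤ (T * C).card := by nlinarith
    have hsd : ((R \ (T * C)).card : ℝ) + (T * C).card = R.card := by
      exact_mod_cast Finset.card_sdiff_add_card_eq_card hCR
    have hA₁ : h (T * C) ≤ l / (1 - ε) * (T * C).card := by
      rw [div_mul_eq_mul_div, le_div_iff₀ hq]
      nlinarith [hh.mul_le T C, mul_le_mul_of_nonneg_left hTl (Nat.cast_nonneg (α := ℝ) C.card),
        mul_le_mul_of_nonneg_left hC hl]
    rcases le_total ((R \ (T * C)).card : ℝ) (η * R.card) with hsmall | hlarge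
    · exact ⟨T * C, hCR, hsmall, hA₁⟩
    · have hdef : (leftDefect K (R \ (T * C)) : ℝ) ≤ δ * (R \ (T * C)).card := by
        have h1 : (leftDefect K (R \ (T * C)) : ℝ)
            ≤ leftDefect K R + C.card * leftDefect K T := by
          exact_mod_cast leftDefect_sdiff_le K T C R
        have h2 : (C.card : ℝ) * leftDefect K T ≤ δ * η / 2 * R.card := by
          calc (C.card : ℝ) * leftDefect K T
              ≤ C.card * (δ * η * (1 - ε) / 2 * T.card) := by gcongr
            _ = δ * η / 2 * ((1 - ε) * (T.card * C.card)) := by ring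
            _ ≤ δ * η / 2 * R.card := by
              gcongr
              linarith [Nat.cast_nonneg (α := ℝ) (R \ (T * C)).card]
        have h3 := mul_le_mul_of_nonneg_left hlarge hδ.le
        linarith
      obtain ⟨A, hAR, hAc, hAl⟩ := ih _ hdef
      refine ⟨T * C ∪ A, Finset.union_subset hCR (hAR.trans Finset.sdiff_subset), ?_, ?_⟩
      · have : R \ (T * C ∪ A) = (R \ (T * C)) \ A := by
          rw [sdiff_sdiff_left]; rfl
        rw [this]
        refine hAc.trans ?_
        rw [hη, pow_succ, mul_assoc]
        gcongr
        · exact pow_nonneg (by linarith) _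
        · linarith
      · have hdisj : Disjoint (T * C) A :=
          Finset.disjoint_left.2 fun x hx hxA => (Finset.mem_sdiff.1 (hAR hxA)).2 hx
        rw [Finset.card_union_of_disjoint hdisj]
        push_cast
        linarith [hh.union_le (T * C) A]

/-- Ornstein–Weiss: if arbitrarily invariant tiles have `h`-density at most `l`, then every
sufficiently invariant finite set has `h`-density at most `l'`, for any given
`l' > l`. -/
lemma IsOWFunction.le_of_invariant {h : Finset G → ℝ} (hh : IsOWFunction h) {b : ℝ}
    (hb : ∀ A, h A ≤ b * A.card) {l l' : ℝ} (hl0 : 0 ≤ l) (hll : l < l')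
    (htile : ∀ (K : Finset G) (δ : ℝ), 0 < δ → ∃ T : Finset G, T.Nonempty ∧
      leftDefect K T ≤ δ * T.card ∧ h T ≤ l * T.card) :
    ∃ (K : Finset G) (δ : ℝ), 0 < δ ∧ ∀ R : Finset G, leftDefect K R ≤ δ * R.card →
      h R ≤ l' * R.card := by
  have hb0 : 0 ≤ b := by simpa using (hh.nonneg {1}).trans (hb {1})
  obtain ⟨m, hlm, hml⟩ := exists_between hll
  have hm : 0 < m := hl0.trans_lt hlm
  -- `l / (1 - ε) ≤ m` for this choice
  obtain ⟨ε, hε, hε'⟩ := exists_between (sub_pos.2 ((div_lt_one hm).2 hlm))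
  have hlm0 : 0 ≤ l / m := by positivity
  have hε1 : ε < 1 := by linarith
  have hq : 0 < 1 - ε := by linarith
  have hdiv : l / (1 - ε) ≤ m := by
    rw [div_le_iff₀ hq]
    have : l / m ≤ 1 - ε := by linarith
    rw [div_le_iff₀ hm] at this
    linarith
  obtain ⟨n, hn⟩ := exists_pow_lt_of_lt_one (show 0 < (l' - m) / (b + 1) by
    apply div_pos <;> linarith) (show 1 - ε / 2 < 1 by linarith)
  rw [lt_div_iff₀ (by linarith)] at hn
  obtain ⟨K, δ, hδ, H⟩ := hh.exists_large_subset htile hε hε1 n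
  refine ⟨K, δ, hδ, fun R hR => ?_⟩
  obtain ⟨A, hAR, hAc, hAl⟩ := H R hR
  have hpow : 0 ≤ (1 - ε / 2) ^ n := pow_nonneg (by linarith) _
  have h1 : h R ≤ h A + h (R \ A) := by
    simpa [Finset.union_sdiff_of_subset hAR] using hh.union_le A (R \ A)
  have h2 : h A ≤ m * R.card :=
    hAl.trans (by
      have : (A.card : ℝ) ≤ R.card := by exact_mod_cast Finset.card_le_card hAR
      gcongr)
  have h3 : h (R \ A) ≤ (l' - m) * R.card :=
    calc h (R \ A) ≤ b * (R \ A).card := hb _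
      _ ≤ b * ((1 - ε / 2) ^ n * R.card) := by gcongr
      _ = b * (1 - ε / 2) ^ n * R.card := by ring
      _ ≤ (l' - m) * R.card := by gcongr; nlinarith
  linarith

lemma IsFolnerSeq.eventually_leftDefect_le {F : ℕ → Finset G} (hF : IsFolnerSeq F) (K : Finset G)
    {δ : ℝ} (hδ : 0 < δ) : ∀ᶠ n in atTop, leftDefect K (F n) ≤ δ * (F n).card := by
  have hsum : Tendsto (fun n => (leftDefect K (F n) : ℝ) / (F n).card) atTop (𝓝 0) := by
    have := tendsto_finsetSum K fun k _ => hF.tendsto k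
    simp only [Finset.sum_const_zero] at this
    refine this.congr fun n => ?_
    rw [leftDefect, Nat.cast_sum, Finset.sum_div]
    refine Finset.sum_congr rfl fun k _ => ?_
    rw [← Set.ncard_coe_finset (F n \ k • F n), Finset.coe_sdiff, Finset.coe_smul_finset]
    rfl
  filter_upwards [hsum.eventually_lt_const hδ] with n hn
  have : (0 : ℝ) < (F n).card := by exact_mod_cast (hF.nonempty n).card_pos
  exact ((div_lt_iff₀ this).1 hn).le

/-- The upper density of an Ornstein–Weiss function along one Følner sequence bounds its upper
density along any other. -/
lemma IsOWFunction.eventually_le {h : Finset G → ℝ} (hh : IsOWFunction h) {b : ℝ}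
    (hb : ∀ A, h A ≤ b * A.card) {F F' : ℕ → Finset G} (hF : IsFolnerSeq F)
    (hF' : IsFolnerSeq F') {l l' : ℝ} (hll : l < l')
    (hl : ∀ᶠ n in atTop, h (F n) ≤ l * (F n).card) :
    ∀ᶠ n in atTop, h (F' n) ≤ l' * (F' n).card := by
  have hl0 : 0 ≤ l := by
    obtain ⟨n, hn⟩ := hl.exists
    have : (0 : ℝ) < (F n).card := by exact_mod_cast (hF.nonempty n).card_pos
    by_contra! hneg
    nlinarith [hh.nonneg (F n)]
  obtain ⟨K, δ, hδ, H⟩ := hh.le_of_invariant hb hl0 hll fun K δ hδ => by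
    obtain ⟨n, h1, h2⟩ := ((hF.eventually_leftDefect_le K hδ).and hl).exists
    exact ⟨F n, hF.nonempty n, h1, h2⟩
  exact (hF'.eventually_leftDefect_le K hδ).mono fun n hn => H _ hn

end Tiling

/-! ### Rates of growth -/

section Rate

lemma card_ereal_nonneg {α : Type*} (F : Finset α) : (0 : EReal) ≤ ((F.card : ℝ) : EReal) :=
  EReal.coe_nonneg.2 (Nat.cast_nonneg _)

variable {G X Y : Type*} [Group G] [MetricSpace X] [MulAction G X] [MetricSpace Y] [MulAction G Y]

/-- The normalised logarithm `(1 / |F|) log s_F(d, ε, E)`. -/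
def sepEntropy (F : Finset G) (ε : ℝ) (E : Set X) : EReal :=
  ENNReal.log ((sepNum F ε E : ℕ∞) : ENNReal) / ((F.card : ℝ) : EReal)

/-- The normalised logarithm `(1 / |F|) log (covNum F ε E)`; the junk value `log 0 = 0` makes it
meaningful only for nonempty `E`. -/
def covEntropy (F : Finset G) (ε : ℝ) (E : Set X) : ℝ :=
  Real.log (covNum F ε E) / F.card

lemma sepRate_eq_limsup (F : ℕ → Finset G) (ε : ℝ) (E : Set X) :
    sepRate F ε E = limsup (fun n => sepEntropy (F n) ε E) atTop := rfl

lemma sepEntropy_nonneg (F : Finset G) (ε : ℝ) {E : Set X} (hE : E.Nonempty) :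
    0 ≤ sepEntropy F ε E := by
  obtain ⟨x, hx⟩ := hE
  have h1 : (1 : ℕ∞) ≤ sepNum F ε E := by
    rw [← Set.encard_singleton x]
    exact le_iSup (fun K : {K : Set X // K ⊆ E ∧ IsSep F ε K} => (K : Set X).encard)
      ⟨{x}, Set.singleton_subset_iff.2 hx, fun y hy z hz h => absurd (hy.trans hz.symm) h⟩
  refine EReal.div_nonneg ?_ (card_ereal_nonneg F)
  rw [← ENNReal.log_one, ENNReal.log_le_log_iff]
  exact_mod_cast h1

lemma sepRate_nonneg (F : ℕ → Finset G) (ε : ℝ) {E : Set X} (hE : E.Nonempty) :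
    0 ≤ sepRate F ε E :=
  le_limsup_of_frequently_le (Eventually.of_forall fun n => sepEntropy_nonneg (F n) ε hE).frequently

lemma sepEntropy_empty {F : Finset G} (hF : F.Nonempty) (ε : ℝ) :
    sepEntropy F ε (∅ : Set X) = ⊥ := by
  have h0 : sepNum F ε (∅ : Set X) = 0 := by
    refine le_antisymm (iSup_le fun K => ?_) zero_le
    simp [Set.subset_empty_iff.1 K.2.1]
  rw [sepEntropy, h0, ENat.toENNReal_zero, ENNReal.log_zero]
  exact EReal.bot_div_of_pos_ne_top (by exact_mod_cast hF.card_pos) (EReal.coe_ne_top _)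

lemma log_natCast {n : ℕ} (hn : 0 < n) :
    ENNReal.log (((n : ℕ∞) : ENNReal)) = (Real.log n : EReal) := by
  rw [ENat.toENNReal_coe, ← ENNReal.ofReal_natCast, ENNReal.log_ofReal_of_pos]
  exact_mod_cast hn

lemma sepEntropy_add_le {ε : ℝ} (hε : 0 ≤ ε) (F : Finset G) (M : Set X) (L : Set Y) :
    sepEntropy F ε M + sepEntropy F ε L ≤ sepEntropy F ε (M ×ˢ L) := by
  rw [sepEntropy, sepEntropy, sepEntropy, ← EReal.add_div_of_nonneg_right (card_ereal_nonneg F),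
    ← ENNReal.log_mul_add]
  refine EReal.div_le_div_right_of_nonneg (card_ereal_nonneg F) (ENNReal.log_le_log ?_)
  rw [← ENat.toENNReal_mul, ENat.toENNReal_le]
  exact sepNum_mul_le hε F M L

variable [CompactSpace X] [CompactSpace Y]

lemma log_covNum_div {ε : ℝ} (hε : 0 < ε) (F : Finset G) {E : Set X} (hE : E.Nonempty) :
    ENNReal.log ((covNum F ε E : ℕ∞) : ENNReal) / ((F.card : ℝ) : EReal) = covEntropy F ε E := by
  rw [log_natCast (covNum_pos hε F hE), covEntropy, EReal.coe_div]

lemma sepEntropy_le_covEntropy {ε : ℝ} (hε : 0 < ε) (F : Finset G) {E : Set X}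
    (hE : E.Nonempty) : sepEntropy F ε E ≤ covEntropy F ε E := by
  rw [← log_covNum_div hε F hE]
  refine EReal.div_le_div_right_of_nonneg (card_ereal_nonneg F) (ENNReal.log_le_log ?_)
  exact_mod_cast sepNum_le_covNum hε F E

lemma covEntropy_le_sepEntropy_half {ε : ℝ} (hε : 0 < ε) (F : Finset G) {E : Set X}
    (hE : E.Nonempty) : covEntropy F ε E ≤ sepEntropy F (ε / 2) E := by
  rw [← log_covNum_div hε F hE]
  refine EReal.div_le_div_right_of_nonneg (card_ereal_nonneg F) (ENNReal.log_le_log ?_)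
  have := covNum_two_mul_le_sepNum (half_pos hε) F E hE
  rw [mul_div_cancel₀ _ two_ne_zero] at this
  exact_mod_cast this

lemma covEntropy_prod_le {ε : ℝ} (hε : 0 < ε) (F : Finset G) {M : Set X} {L : Set Y}
    (hM : M.Nonempty) (hL : L.Nonempty) :
    covEntropy F ε (M ×ˢ L) ≤ covEntropy F ε M + covEntropy F ε L := by
  have h1 : (0 : ℝ) < covNum F ε M := by exact_mod_cast covNum_pos hε F hM
  have h2 : (0 : ℝ) < covNum F ε L := by exact_mod_cast covNum_pos hε F hL
  have h3 : (0 : ℝ) < covNum F ε (M ×ˢ L) := by exact_mod_cast covNum_pos hε F (hM.prod hL)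
  rw [covEntropy, covEntropy, covEntropy, ← add_div, ← Real.log_mul h1.ne' h2.ne']
  gcongr
  exact_mod_cast covNum_prod_le hε F M L

lemma sepRate_prod_le (F : ℕ → Finset G) {ε : ℝ} (hε : 0 < ε) {M : Set X} {L : Set Y}
    (hM : M.Nonempty) (hL : L.Nonempty) :
    sepRate F ε (M ×ˢ L) ≤ sepRate F (ε / 2) M + sepRate F (ε / 2) L := by
  have h : ∀ n, sepEntropy (F n) ε (M ×ˢ L) ≤
      sepEntropy (F n) (ε / 2) M + sepEntropy (F n) (ε / 2) L := fun n =>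
    calc sepEntropy (F n) ε (M ×ˢ L) ≤ covEntropy (F n) ε (M ×ˢ L) :=
          sepEntropy_le_covEntropy hε _ (hM.prod hL)
      _ ≤ ((covEntropy (F n) ε M + covEntropy (F n) ε L : ℝ) : EReal) :=
          EReal.coe_le_coe_iff.2 (covEntropy_prod_le hε _ hM hL)
      _ = (covEntropy (F n) ε M : EReal) + covEntropy (F n) ε L := EReal.coe_add _ _
      _ ≤ _ := add_le_add (covEntropy_le_sepEntropy_half hε _ hM)
          (covEntropy_le_sepEntropy_half hε _ hL)
  have hM0 := sepRate_nonneg F (ε / 2) hM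
  have hL0 := sepRate_nonneg F (ε / 2) hL
  refine (limsup_le_limsup (Eventually.of_forall h)).trans (EReal.limsup_add_le ?_ ?_)
  · exact Or.inl (EReal.bot_lt_zero.trans_le hM0).ne'
  · exact Or.inr (EReal.bot_lt_zero.trans_le hL0).ne'

lemma isOWFunction_log_covNum [DecidableEq G] {ε : ℝ} (hε : 0 < ε) {E : Set X} (hE : E.Nonempty)
    (hinv : IsInvariantSet G E) : IsOWFunction fun F : Finset G => Real.log (covNum F ε E) := by
  have hpos : ∀ F : Finset G, (0 : ℝ) < covNum F ε E := fun F => by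
    exact_mod_cast covNum_pos hε F hE
  refine ⟨fun A => Real.log_natCast_nonneg _, fun A B => ?_, fun A c => ?_, ?_⟩
  · rw [← Real.log_mul (hpos A).ne' (hpos B).ne']
    exact Real.log_le_log (hpos _) (by exact_mod_cast covNum_union_le hε A B E)
  · refine Real.log_le_log (hpos _) ?_
    rw [Finset.mul_singleton]
    exact_mod_cast covNum_image_mul_right_le hε A hinv c
  · obtain ⟨n, hn⟩ := exists_covNum_le_pow G X hε
    have h1 : covNum (∅ : Finset G) ε E = 1 :=
      le_antisymm (by simpa using hn ∅ E) (covNum_pos hε ∅ hE)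
    simp [h1]

/-- For an invariant set the growth rate of covering numbers is the same along all Følner
sequences. -/
lemma limsup_covEntropy_le {F F' : ℕ → Finset G} (hF : IsFolnerSeq F) (hF' : IsFolnerSeq F')
    {ε : ℝ} (hε : 0 < ε) {E : Set X} (hE : E.Nonempty) (hinv : IsInvariantSet G E) :
    limsup (fun n => (covEntropy (F' n) ε E : EReal)) atTop ≤
      limsup (fun n => (covEntropy (F n) ε E : EReal)) atTop := by
  classical
  obtain ⟨N, hN⟩ := exists_covNum_le_pow G X hε
  have hb : ∀ A : Finset G, Real.log (covNum A ε E) ≤ Real.log N * A.card := fun A => by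
    rw [mul_comm, ← Real.log_pow]
    exact Real.log_le_log (by exact_mod_cast covNum_pos hε A hE) (by exact_mod_cast hN A E)
  have hcard : ∀ {F : ℕ → Finset G}, IsFolnerSeq F → ∀ n, (0 : ℝ) < (F n).card := fun hF n => by
    exact_mod_cast (hF.nonempty n).card_pos
  refine EReal.le_of_forall_lt_iff_le.1 fun l' hl' => ?_
  obtain ⟨l, hl, hll⟩ := EReal.lt_iff_exists_real_btwn.1 hl'
  refine limsup_le_of_le (by isBoundedDefault) ?_
  have h1 : ∀ᶠ n in atTop, Real.log (covNum (F n) ε E) ≤ l * (F n).card := by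
    filter_upwards [eventually_lt_of_limsup_lt hl] with n hn
    exact ((div_lt_iff₀ (hcard hF n)).1 (EReal.coe_lt_coe_iff.1 hn)).le
  filter_upwards [(isOWFunction_log_covNum hε hE hinv).eventually_le hb hF hF'
    (EReal.coe_lt_coe_iff.1 hll) h1] with n hn
  exact EReal.coe_le_coe_iff.2 ((div_le_iff₀ (hcard hF' n)).2 hn)

lemma sepRate_le_sepRate_half {F F' : ℕ → Finset G} (hF : IsFolnerSeq F) (hF' : IsFolnerSeq F')
    {ε : ℝ} (hε : 0 < ε) {E : Set X} (hE : E.Nonempty) (hinv : IsInvariantSet G E) :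
    sepRate F' ε E ≤ sepRate F (ε / 2) E :=
  calc sepRate F' ε E ≤ _ :=
        limsup_le_limsup (Eventually.of_forall fun n => sepEntropy_le_covEntropy hε (F' n) hE)
    _ ≤ _ := limsup_covEntropy_le hF hF' hε hE hinv
    _ ≤ _ := limsup_le_limsup
        (Eventually.of_forall fun n => covEntropy_le_sepEntropy_half hε (F n) hE)

end Rate

/-! ### Insensitivity to halving the scale -/

section Scale

lemma map_half_nhdsGT_zero : map (fun ε : ℝ => ε / 2) (𝓝[>] 0) = 𝓝[>] 0 := by
  have hscale : ∀ a : ℝ, 0 < a → Tendsto (fun ε : ℝ => ε * a) (𝓝[>] 0) (𝓝[>] 0) := fun a ha => by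
    refine tendsto_nhdsWithin_iff.2 ⟨?_, ?_⟩
    · have : Tendsto (fun ε : ℝ => ε * a) (𝓝 0) (𝓝 (0 * a)) := tendsto_id.mul_const a
      rw [zero_mul] at this
      exact this.mono_left nhdsWithin_le_nhds
    · filter_upwards [self_mem_nhdsWithin] with ε hε using mul_pos hε ha
  refine map_eq_of_inverse (fun ε => ε * 2) (by ext; simp) ?_ (hscale 2 two_pos)
  simpa only [div_eq_mul_inv] using hscale 2⁻¹ (by norm_num)

lemma abs_log_half_div_tendsto :
    Tendsto (fun ε : ℝ => |Real.log (ε / 2)| / |Real.log ε|) (𝓝[>] 0) (𝓝 1) := by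
  have h1 : Tendsto (fun ε : ℝ => 1 - Real.log 2 / Real.log ε) (𝓝[>] 0) (𝓝 1) := by
    simpa using (Real.tendsto_log_nhdsGT_zero.const_div_atBot (Real.log 2)).const_sub 1
  have := h1.abs
  rw [abs_one] at this
  refine this.congr' ?_
  filter_upwards [Ioo_mem_nhdsGT one_pos] with ε hε
  have : Real.log ε ≠ 0 := (Real.log_neg hε.1 hε.2).ne
  rw [← abs_div, Real.log_div hε.1.ne' two_ne_zero, sub_div, div_self this]

lemma eventually_div_abs_log_le {f g : ℝ → EReal}
    (hfg : ∀ ε > 0, f ε ≤ g (ε / 2)) : ∀ᶠ ε : ℝ in 𝓝[>] 0,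
      f ε / ((|Real.log ε| : ℝ) : EReal) ≤ ((|Real.log (ε / 2)| / |Real.log ε| : ℝ) : EReal) *
        (g (ε / 2) / ((|Real.log (ε / 2)| : ℝ) : EReal)) := by
  filter_upwards [Ioo_mem_nhdsGT one_pos] with ε hε
  have h2 : (0 : ℝ) < |Real.log (ε / 2)| :=
    abs_pos.2 (Real.log_neg (half_pos hε.1) (by linarith [hε.1, hε.2])).ne
  rw [EReal.coe_div, EReal.mul_comm, EReal.div_mul_div_comm, EReal.mul_comm,
    ← EReal.div_mul_div_comm, EReal.div_self (EReal.coe_ne_bot _) (EReal.coe_ne_top _)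
      (by exact_mod_cast h2.ne'), one_mul]
  exact EReal.div_le_div_right_of_nonneg (by exact_mod_cast abs_nonneg _) (hfg ε hε.1)

lemma limsup_div_abs_log_le {f g : ℝ → EReal} (hg : ∀ ε, 0 ≤ g ε)
    (hfg : ∀ ε > 0, f ε ≤ g (ε / 2)) :
    limsup (fun ε : ℝ => f ε / ((|Real.log ε| : ℝ) : EReal)) (𝓝[>] 0) ≤
      limsup (fun ε : ℝ => g ε / ((|Real.log ε| : ℝ) : EReal)) (𝓝[>] 0) := by
  have hρ := (EReal.tendsto_coe.2 abs_log_half_div_tendsto).limsup_eq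
  refine (limsup_le_limsup (eventually_div_abs_log_le hfg)).trans ?_
  refine (EReal.limsup_mul_le ?_ ?_ ?_ ?_).trans ?_
  · exact (Eventually.of_forall fun ε => by positivity).frequently
  · exact Eventually.of_forall fun ε => EReal.div_nonneg (hg _) (by positivity)
  · left; rw [hρ]; simp
  · left; rw [hρ]; exact EReal.coe_ne_top 1
  · rw [hρ, EReal.coe_one, one_mul]
    conv_rhs => rw [← map_half_nhdsGT_zero]
    rfl

lemma liminf_div_abs_log_le {f g : ℝ → EReal} (hg : ∀ ε, 0 ≤ g ε)
    (hfg : ∀ ε > 0, f ε ≤ g (ε / 2)) :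
    liminf (fun ε : ℝ => f ε / ((|Real.log ε| : ℝ) : EReal)) (𝓝[>] 0) ≤
      liminf (fun ε : ℝ => g ε / ((|Real.log ε| : ℝ) : EReal)) (𝓝[>] 0) := by
  have hρ := (EReal.tendsto_coe.2 abs_log_half_div_tendsto).limsup_eq
  refine (liminf_le_liminf (eventually_div_abs_log_le hfg)).trans ?_
  refine (EReal.liminf_mul_le ?_ ?_ ?_ ?_).trans ?_
  · exact Eventually.of_forall fun ε => by positivity
  · exact Eventually.of_forall fun ε => EReal.div_nonneg (hg _) (by positivity)
  · left; rw [hρ]; simp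
  · left; rw [hρ]; exact EReal.coe_ne_top 1
  · rw [hρ, EReal.coe_one, one_mul]
    conv_rhs => rw [← map_half_nhdsGT_zero]
    rfl

end Scale

/-! ### Metric mean dimension -/

section Mdim

variable {G X Y : Type*} [Group G] [MetricSpace X] [MulAction G X] [MetricSpace Y] [MulAction G Y]

lemma IsFolnerSeq.comp {F : ℕ → Finset G} (hF : IsFolnerSeq F) {φ : ℕ → ℕ} (hφ : StrictMono φ) :
    IsFolnerSeq (F ∘ φ) :=
  ⟨fun n => hF.nonempty (φ n), fun g => (hF.tendsto g).comp hφ.tendsto_atTop⟩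

lemma lowerMdim_le_upperMdim (F : ℕ → Finset G) (E : Set X) : lowerMdim F E ≤ upperMdim F E :=
  liminf_le_limsup

lemma upperMdim_empty {F : ℕ → Finset G} (hF : IsFolnerSeq F) :
    upperMdim F (∅ : Set X) = ⊥ := by
  have h : ∀ᶠ ε : ℝ in 𝓝[>] 0,
      sepRate F ε (∅ : Set X) / ((|Real.log ε| : ℝ) : EReal) = ⊥ := by
    filter_upwards [Ioo_mem_nhdsGT one_pos] with ε hε
    have : sepRate F ε (∅ : Set X) = ⊥ := by
      simp_rw [sepRate_eq_limsup, sepEntropy_empty (hF.nonempty _), limsup_const]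
    rw [this]
    exact EReal.bot_div_of_pos_ne_top
      (EReal.coe_pos.2 (abs_pos.2 (Real.log_neg hε.1 hε.2).ne)) (EReal.coe_ne_top _)
  rw [upperMdim, limsup_congr h, limsup_const]

lemma lowerMdim_empty {F : ℕ → Finset G} (hF : IsFolnerSeq F) :
    lowerMdim F (∅ : Set X) = ⊥ :=
  le_bot_iff.1 ((lowerMdim_le_upperMdim F _).trans (upperMdim_empty hF).le)

lemma lowerMdim_nonneg (F : ℕ → Finset G) {E : Set X} (hE : E.Nonempty) : 0 ≤ lowerMdim F E :=
  le_liminf_of_le (by isBoundedDefault) (Eventually.of_forall fun ε =>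
    EReal.div_nonneg (sepRate_nonneg F ε hE) (by positivity))

lemma upperMdim_nonneg (F : ℕ → Finset G) {E : Set X} (hE : E.Nonempty) : 0 ≤ upperMdim F E :=
  (lowerMdim_nonneg F hE).trans (lowerMdim_le_upperMdim F E)

lemma IsInvariantSet.isFolnerIndependent [CompactSpace X] {E : Set X} (hinv : IsInvariantSet G E) :
    IsFolnerIndependent G E := by
  intro F F' hF hF'
  rcases E.eq_empty_or_nonempty with rfl | hE
  · simp only [upperMdim_empty hF, upperMdim_empty hF', lowerMdim_empty hF, lowerMdim_empty hF',
      and_self]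
  have h1 : ∀ ε > 0, sepRate F ε E ≤ sepRate F' (ε / 2) E :=
    fun ε hε => sepRate_le_sepRate_half hF' hF hε hE hinv
  have h2 : ∀ ε > 0, sepRate F' ε E ≤ sepRate F (ε / 2) E :=
    fun ε hε => sepRate_le_sepRate_half hF hF' hε hE hinv
  have n1 : ∀ ε, 0 ≤ sepRate F ε E := fun ε => sepRate_nonneg F ε hE
  have n2 : ∀ ε, 0 ≤ sepRate F' ε E := fun ε => sepRate_nonneg F' ε hE
  exact ⟨(limsup_div_abs_log_le n2 h1).antisymm (limsup_div_abs_log_le n1 h2),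
    (liminf_div_abs_log_le n2 h1).antisymm (liminf_div_abs_log_le n1 h2)⟩

lemma upperMdim_prod_le [CompactSpace X] [CompactSpace Y] (F : ℕ → Finset G) {M : Set X}
    {L : Set Y} (hM : M.Nonempty) (hL : L.Nonempty) :
    upperMdim F (M ×ˢ L) ≤ upperMdim F M + upperMdim F L := by
  have h := limsup_div_abs_log_le (f := fun ε => sepRate F ε (M ×ˢ L))
    (g := fun ε => sepRate F ε M + sepRate F ε L)
    (fun ε => add_nonneg (sepRate_nonneg F ε hM) (sepRate_nonneg F ε hL))
    fun ε hε => sepRate_prod_le F hε hM hL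
  refine h.trans ?_
  have hdiv : ∀ ε : ℝ, (sepRate F ε M + sepRate F ε L) / ((|Real.log ε| : ℝ) : EReal) =
      sepRate F ε M / ((|Real.log ε| : ℝ) : EReal) +
        sepRate F ε L / ((|Real.log ε| : ℝ) : EReal) := fun ε =>
    EReal.add_div_of_nonneg_right (by positivity)
  simp_rw [hdiv]
  exact EReal.limsup_add_le (Or.inl (EReal.bot_lt_zero.trans_le (upperMdim_nonneg F hM)).ne')
    (Or.inr (EReal.bot_lt_zero.trans_le (upperMdim_nonneg F hL)).ne')

lemma lowerMdim_le_liminf_seq (F : ℕ → Finset G) (E : Set X) {e : ℕ → ℝ}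
    (he : Tendsto e atTop (𝓝[>] 0)) :
    lowerMdim F E ≤
      liminf (fun j => sepRate F (e j) E / ((|Real.log (e j)| : ℝ) : EReal)) atTop :=
  liminf_le_liminf_of_le (g := map e atTop)
    (u := fun ε => sepRate F ε E / ((|Real.log ε| : ℝ) : EReal)) he

/-- Superadditivity after passing to a subsequence. At a fixed scale the two entropies may be
large along different parts of `F`, so `lowerMdim` need not be superadditive along `F` itself.
Diagonal extraction, over a sequence of scales at which the product stays below `b`, makes all the
entropies of both factors converge, and limits add. -/
lemma exists_subseq_lowerMdim_add_le (F : ℕ → Finset G) (M : Set X) (L : Set Y) {b : EReal}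
    (hb : lowerMdim F (M ×ˢ L) < b) :
    ∃ φ : ℕ → ℕ, StrictMono φ ∧ lowerMdim (F ∘ φ) M + lowerMdim (F ∘ φ) L ≤ b := by
  obtain ⟨e, he, hlt⟩ := exists_seq_forall_of_frequently
    ((frequently_lt_of_liminf_lt (by isBoundedDefault) hb).and_eventually
      self_mem_nhdsWithin)
  obtain ⟨a, φ, hφ, ha⟩ := CompactSpace.tendsto_subseq
    fun n (j : ℕ) => (sepEntropy (F n) (e j) M, sepEntropy (F n) (e j) L)
  refine ⟨φ, hφ, ?_⟩
  have hadd : ∀ j, sepRate (F ∘ φ) (e j) M + sepRate (F ∘ φ) (e j) L ≤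
      sepRate F (e j) (M ×ˢ L) := by
    intro j
    have hj := tendsto_pi_nhds.1 ha j
    have h2 : Tendsto (fun n => sepEntropy ((F ∘ φ) n) (e j) L) atTop (𝓝 (a j).2) :=
      (continuous_snd.tendsto _).comp hj
    calc sepRate (F ∘ φ) (e j) M + sepRate (F ∘ φ) (e j) L
        = limsup (fun n => sepEntropy ((F ∘ φ) n) (e j) M) atTop +
          liminf (fun n => sepEntropy ((F ∘ φ) n) (e j) L) atTop := by
            rw [sepRate_eq_limsup, sepRate_eq_limsup, h2.limsup_eq, h2.liminf_eq]
      _ ≤ limsup (fun n => sepEntropy ((F ∘ φ) n) (e j) M + sepEntropy ((F ∘ φ) n) (e j) L)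
          atTop := EReal.le_limsup_add
      _ ≤ limsup (fun n => sepEntropy ((F ∘ φ) n) (e j) (M ×ˢ L)) atTop :=
          limsup_le_limsup (Eventually.of_forall fun n => sepEntropy_add_le (hlt j).2.le _ M L)
      _ ≤ sepRate F (e j) (M ×ˢ L) :=
          limsup_le_limsup_of_le (f := map φ atTop) (u := fun n => sepEntropy (F n) (e j) (M ×ˢ L))
            hφ.tendsto_atTop
  refine (add_le_add (lowerMdim_le_liminf_seq _ M he) (lowerMdim_le_liminf_seq _ L he)).trans
    (EReal.le_liminf_add.trans ?_)
  refine liminf_le_of_le (by isBoundedDefault) fun c hc => ?_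
  obtain ⟨j, hj⟩ := hc.exists
  refine hj.trans (le_trans ?_ (hlt j).1.le)
  rw [Pi.add_apply, ← EReal.add_div_of_nonneg_right (by positivity)]
  exact EReal.div_le_div_right_of_nonneg (by positivity) (hadd j)

lemma add_le_lowerMdim_prod {F : ℕ → Finset G} (hF : IsFolnerSeq F) {M : Set X} {L : Set Y}
    (hM : IsFolnerIndependent G M) (hL : IsFolnerIndependent G L) :
    lowerMdim F M + lowerMdim F L ≤ lowerMdim F (M ×ˢ L) := by
  refine le_of_forall_gt_imp_ge_of_dense fun b hb => ?_
  obtain ⟨φ, hφ, hle⟩ := exists_subseq_lowerMdim_add_le F M L hb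
  rwa [(hM _ _ hF (hF.comp hφ)).2, (hL _ _ hF (hF.comp hφ)).2]

end Mdim

end AmenableMdim

end

theorem mainTheorem2 {G X Y : Type*} [Group G] [Countable G]
    [MetricSpace X] [CompactSpace X] [MulAction G X] [ContinuousConstSMul G X]
    [MetricSpace Y] [CompactSpace Y] [MulAction G Y] [ContinuousConstSMul G Y]
    (F : ℕ → Finset G) (hF : AmenableMdim.IsFolnerSeq F)
    (M : Set X) (L : Set Y) (hM : IsCompact M) (hL : IsCompact L)
    (hMF : AmenableMdim.IsInvariantSet G M ∨ AmenableMdim.IsFolnerIndependent G M)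
    (hLF : AmenableMdim.IsInvariantSet G L ∨ AmenableMdim.IsFolnerIndependent G L)
    (hMdim : AmenableMdim.lowerMdim F M = AmenableMdim.upperMdim F M)
    (hLdim : AmenableMdim.lowerMdim F L = AmenableMdim.upperMdim F L) :
    ∀ F' : ℕ → Finset G, AmenableMdim.IsFolnerSeq F' →
      AmenableMdim.lowerMdim F' (M ×ˢ L)
          = AmenableMdim.upperMdim F M + AmenableMdim.upperMdim F L ∧
      AmenableMdim.upperMdim F' (M ×ˢ L)
          = AmenableMdim.upperMdim F M + AmenableMdim.upperMdim F L := by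
  intro F' hF'
  have hMi := hMF.elim AmenableMdim.IsInvariantSet.isFolnerIndependent id
  have hLi := hLF.elim AmenableMdim.IsInvariantSet.isFolnerIndependent id
  rcases M.eq_empty_or_nonempty with rfl | hMne
  · rw [Set.empty_prod, AmenableMdim.lowerMdim_empty hF', AmenableMdim.upperMdim_empty hF',
      AmenableMdim.upperMdim_empty hF, EReal.bot_add]
    exact ⟨rfl, rfl⟩
  rcases L.eq_empty_or_nonempty with rfl | hLne
  · rw [Set.prod_empty, AmenableMdim.lowerMdim_empty hF', AmenableMdim.upperMdim_empty hF',
      AmenableMdim.upperMdim_empty hF, EReal.add_bot]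
    exact ⟨rfl, rfl⟩
  have hlow := AmenableMdim.add_le_lowerMdim_prod hF' hMi hLi
  have hup := AmenableMdim.upperMdim_prod_le F' hMne hLne
  have hle := AmenableMdim.lowerMdim_le_upperMdim F' (M ×ˢ L)
  rw [← (hMi F F' hF hF').2, ← (hLi F F' hF hF').2, hMdim, hLdim] at hlow
  rw [← (hMi F F' hF hF').1, ← (hLi F F' hF hF').1] at hup
  exact ⟨(hle.trans hup).antisymm hlow, hup.antisymm (hlow.trans hle)⟩
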